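/- Let $\mathbb T=\mathbb R^2/\mathbb Z^2$ be embedded in $S^3\subset\mathbb C^2$ as the standard torus by $(\theta,\eta)\mapsto\frac1{\sqrt2}(e^{2\pi i\theta},e^{2\pi i\eta})$. For coprime integers $p,q\ge 0$ let $T(p,q)\subset\mathbb T$ be the image of the line $\mathbb R(p,q)$; regarded in $S^3$ it is the $(p,q)$ torus knot. Put $$J_n=T(4n,(2n-1)^2)\quad(n\ge 2),\qquad K_n=T(4n,(2n+1)^2)\quad(n\ge 0).$$ A band attached to a simple closed curve $C\subset\mathbb T$ is an embedding $\beta:[0,1]^2\to\mathbb T$ with $\beta^{-1}(C)=\{0,1\}\times[0,1]$. Surgery on $C$ along $\beta$ removes $\beta(\{0,1\}\times(0,1))$ from $C$ and adds $\beta([0,1]\times\{0,1\})$. For coprime $p,q>1$, the preimage of $T(p,q)$ in $\mathbb R^2$ consists of the parallel lines $qx-py=k$, $k\in\mathbb Z$. A straight pinch band for $T(p,q)$ is a band that is the image of a parallelogram with one vertex $t_0(p,q)$ and with sides $(a,-b)$ and $\varepsilon(p,q)$ from it, where $t_0\in\mathbb R$, $\varepsilon>0$, $a,b\ge 0$ and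 $qa+pb=1$; that is, it runs straight across from one strand to the next one. A pinch band for a curve $C\subset\mathbb T$ is a band of the form $\varphi\circ\beta_0$, where $\varphi$ is a homeomorphism of $\mathbb T$ isotopic to the identity with $\varphi(T(p,q))=C$ for some coprime $p,q>1$, and $\beta_0$ is a straight pinch band for $T(p,q)$. A pinch move on $C$ is surgery on $C$ along a pinch band for $C$. Then for every integer $n\ge 2$, applying four successive pinch moves to $J_n$ yields the knot $K_{n-2}$: there are curves $C_0=J_n,C_1,C_2,C_3,C_4$ on $\mathbb T$ such that each $C_{i+1}$ is the result of a pinch move on $C_i$, and for every such sequence of curves, $C_4$ is ambient isotopic in $S^3$ to $K_{n-2}=T(4(n-2),(2(n-2)+1)^2)$. (For $n=2$ this is the unknot $K_0=T(0,1)$.) -/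

import Mathlib

namespace TorusKnot

/-! ### Isotopy -/

/-- The homeomorphism `φ` of `X` is the end of an isotopy of `X` that starts at the identity. -/
def IsotopicToId {X : Type*} [TopologicalSpace X] (φ : X ≃ₜ X) : Prop :=
  ∃ F : unitInterval → (X ≃ₜ X),
    Continuous (fun z : unitInterval × X => F z.1 z.2) ∧
      F 0 = Homeomorph.refl X ∧ F 1 = φ

/-- The subsets `A` and `B` of `X` are ambient isotopic in `X`. -/
def AmbientIsotopic {X : Type*} [TopologicalSpace X] (A B : Set X) : Prop :=
  ∃ φ : X ≃ₜ X, IsotopicToId φ ∧ φ '' A = B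

/-! ### The standard torus in the 3-sphere, and torus knots -/

/-- The torus `ℝ² / ℤ²`. -/
abbrev Torus : Type := UnitAddCircle × UnitAddCircle

/-- The covering projection `ℝ² → ℝ² / ℤ²`. -/
def proj (x y : ℝ) : Torus := ((x : UnitAddCircle), (y : UnitAddCircle))

/-- The 3-sphere, as the unit sphere of `ℂ²`. -/
abbrev S3 : Type := Metric.sphere (0 : EuclideanSpace ℂ (Fin 2)) 1

theorem clifford_mem (x : Torus) :
    (!₂[(AddCircle.toCircle x.1 : ℂ) / (Real.sqrt 2 : ℂ),
        (AddCircle.toCircle x.2 : ℂ) / (Real.sqrt 2 : ℂ)] : EuclideanSpace ℂ (Fin 2)) ∈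
      Metric.sphere (0 : EuclideanSpace ℂ (Fin 2)) 1 := by
  rw [mem_sphere_zero_iff_norm, EuclideanSpace.norm_eq]
  simp [Fin.sum_univ_two, div_pow]
  rw [Circle.norm_coe, Circle.norm_coe]
  norm_num

/-- The standard embedding of the torus in the 3-sphere:
`(θ, η) ↦ (e^{2πiθ}, e^{2πiη}) / √2`. -/
noncomputable def clifford (x : Torus) : S3 :=
  ⟨!₂[(AddCircle.toCircle x.1 : ℂ) / (Real.sqrt 2 : ℂ),
      (AddCircle.toCircle x.2 : ℂ) / (Real.sqrt 2 : ℂ)], clifford_mem x⟩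

/-- The torus knot `T(p, q)` in standard position on the torus: the image of the line through
the origin in the direction `(p, q)`. It is a simple closed curve when `p` and `q` are coprime. -/
def T (p q : ℕ) : Set Torus := Set.range (fun t : ℝ => proj (p * t) (q * t))

/-- `J n = T(4n, (2n - 1)²)`, meant for `n ≥ 1`. -/
def J (n : ℕ) : Set Torus := T (4 * n) ((2 * n - 1) ^ 2)

/-- `K n = T(4n, (2n + 1)²)`. -/
def K (n : ℕ) : Set Torus := T (4 * n) ((2 * n + 1) ^ 2)

/-! ### Bands on the torus, band surgery, pinch moves -/

/-- `β` is a band on the torus attached to the curve `C`: an embedded square that meets `C`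
exactly in the two opposite sides `{0} × [0, 1]` and `{1} × [0, 1]`. -/
def IsBand (C : Set Torus) (β : unitInterval × unitInterval → Torus) : Prop :=
  Continuous β ∧ Function.Injective β ∧ β ⁻¹' C = {z | z.1 = 0 ∨ z.1 = 1}

/-- Surgery on `C` along the band `β`: the (open) attaching sides `{0, 1} × (0, 1)` are removed
from `C` and the two other sides `[0, 1] × {0, 1}` of the band are put in. -/
def bandSurgery (C : Set Torus) (β : unitInterval × unitInterval → Torus) : Set Torus :=
  (C \ β '' {z | (z.1 = 0 ∨ z.1 = 1) ∧ z.2 ≠ 0 ∧ z.2 ≠ 1}) ∪ β '' {z | z.2 = 0 ∨ z.2 = 1}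

/-- The straight band of width parameter `ε` that starts at the point with parameter `t₀` of
`T(p, q)` and runs in the direction `(a, -b)`: the image of the parallelogram with vertex
`t₀ (p, q)` and sides `(a, -b)` and `ε (p, q)`. -/
def straightBand (p q : ℕ) (t₀ ε a b : ℝ) (z : unitInterval × unitInterval) : Torus :=
  proj (p * t₀ + (z.1 : ℝ) * a + (z.2 : ℝ) * (ε * p))
    (q * t₀ - (z.1 : ℝ) * b + (z.2 : ℝ) * (ε * q))

/-- A straight band between two adjacent strands of the standard picture of `T(p, q)`.
The preimage of `T(p, q)` in the plane consists of the parallel lines `q x - p y = k`, `k ∈ ℤ`,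
of positive slope. The band leaves a line in a direction `(a, -b)` with `a, b ≥ 0`, that is
horizontally, vertically, or with a negative slope (so it runs across the strands and does not
follow them), and `q a + p b = 1` says that it ends on the next line. -/
def IsStraightPinchBand (p q : ℕ) (β : unitInterval × unitInterval → Torus) : Prop :=
  IsBand (T p q) β ∧
    ∃ t₀ ε a b : ℝ, 0 < ε ∧ 0 ≤ a ∧ 0 ≤ b ∧ q * a + p * b = 1 ∧
      β = straightBand p q t₀ ε a b

/-- `β` is a pinch band for the curve `C` on the torus: some isotopy of the torus carries a
nontrivial torus knot `T(p, q)` in standard position to `C`, and a straight band between adjacent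
strands of `T(p, q)` to `β`. -/
def IsPinchBand (C : Set Torus) (β : unitInterval × unitInterval → Torus) : Prop :=
  ∃ p q : ℕ, 1 < p ∧ 1 < q ∧ Nat.Coprime p q ∧
    ∃ φ : Torus ≃ₜ Torus, IsotopicToId φ ∧ φ '' T p q = C ∧
      ∃ β₀ : unitInterval × unitInterval → Torus, IsStraightPinchBand p q β₀ ∧ β = φ ∘ β₀

/-- The curve `C'` on the torus is the result of a pinch move on the curve `C`. -/
def IsPinchMove (C C' : Set Torus) : Prop :=
  ∃ β : unitInterval × unitInterval → Torus, IsPinchBand C β ∧ C' = bandSurgery C β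

/-- `C 0, …, C m` are the successive curves of a sequence of `m` pinch moves. -/
def IsPinchSequence {m : ℕ} (C : Fin (m + 1) → Set Torus) : Prop :=
  ∀ i : Fin m, IsPinchMove (C i.castSucc) (C i.succ)

end TorusKnot

/-!
With `k = n - 1` one has `J n = T(p, k p + 1)` for `p = 4 n` and `K (n - 2) = T(p, k p + 1)` for
`p = 4 n - 8`, so it is enough to show that a pinch move changes `T(p + 2, k (p + 2) + 1)` into
`T(p, k p + 1)`, up to isotopy of the torus, and that isotopies of the torus extend to the 3-sphere.

The standard position that a pinch move refers to is determined by the curve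
(`eq_of_isotopic`): the displacement of a homeomorphism isotopic to the identity lifts to a bounded
function with values in the plane, and this forces the slopes to agree.

For the effect of a pinch move, a linear automorphism of the torus carries `T(p + 2, k (p + 2) + 1)`
to the vertical circle and `T(p, k p + 1)` to the line of direction `(-2, 1)`, and straight pinch
bands become bands that run once around the torus in a direction `(1, -c)` with `0 < c ≤ 1 / 2`.
After surgery two arcs of the circle are left, and the curve traverses them in opposite directions.
A shear that is increasing along one arc and decreasing along the other makes the curve a graph
that winds twice around the first factor (`ambientIsotopic_bandSurgery_slantedBand_zero`). Such a
curve is a pair of distinct points of a circle, moving with time; since the space of pairs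
`y₁ < y₂ < y₁ + 1` is convex, all such closed curves are isotopic to the line
(`ambientIsotopic_two_strand_graph`).

An isotopy of the torus is extended to the 3-sphere by letting it act on the tori of points whose
coordinates have fixed absolute values, for a time that decreases to zero towards the two core
circles (`AmbientIsotopic.clifford_image`).
-/

open Set Topology unitInterval

namespace TorusKnot

/-! ### Isotopies -/

section Isotopy

variable {X : Type*} [TopologicalSpace X]

theorem IsotopicToId.trans {φ ψ : X ≃ₜ X} (hφ : IsotopicToId φ) (hψ : IsotopicToId ψ) :
    IsotopicToId (φ.trans ψ) := by
  obtain ⟨F, hF, hF0, hF1⟩ := hφ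
  obtain ⟨G, hG, hG0, hG1⟩ := hψ
  refine ⟨fun s => (F s).trans (G s), ?_, by ext; simp [hF0, hG0], by ext; simp [hF1, hG1]⟩
  exact hG.comp (continuous_fst.prodMk hF)

theorem IsotopicToId.conj {φ : X ≃ₜ X} (hφ : IsotopicToId φ) {Y : Type*} [TopologicalSpace Y]
    (e : Y ≃ₜ X) : IsotopicToId ((e.trans φ).trans e.symm) := by
  obtain ⟨F, hF, hF0, hF1⟩ := hφ
  refine ⟨fun s => (e.trans (F s)).trans e.symm, ?_, by ext; simp [hF0], by simp [hF1]⟩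
  exact e.symm.continuous.comp (hF.comp (continuous_fst.prodMk (e.continuous.comp continuous_snd)))

/-- The inverse homeomorphisms of an isotopy of a compact Hausdorff space vary continuously: the
level-preserving map `(s, x) ↦ (s, F s x)` is a homeomorphism of the cylinder. -/
theorem continuous_symm_of_isotopy [CompactSpace X] [T2Space X] {F : I → (X ≃ₜ X)}
    (hF : Continuous fun z : I × X => F z.1 z.2) :
    Continuous fun z : I × X => (F z.1).symm z.2 := by
  let e : I × X ≃ I × X :=
    { toFun := fun z => (z.1, F z.1 z.2)
      invFun := fun z => (z.1, (F z.1).symm z.2)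
      left_inv := fun z => by simp
      right_inv := fun z => by simp }
  have he : Continuous e := continuous_fst.prodMk hF
  exact continuous_snd.comp he.homeoOfEquivCompactToT2.symm.continuous

theorem IsotopicToId.symm [CompactSpace X] [T2Space X] {φ : X ≃ₜ X} (hφ : IsotopicToId φ) :
    IsotopicToId φ.symm := by
  obtain ⟨F, hF, hF0, hF1⟩ := hφ
  exact ⟨fun s => (F s).symm, continuous_symm_of_isotopy hF, by ext; simp [hF0], by simp [hF1]⟩

theorem AmbientIsotopic.trans {A B C : Set X} (h₁ : AmbientIsotopic A B)
    (h₂ : AmbientIsotopic B C) : AmbientIsotopic A C := by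
  obtain ⟨φ, hφ, rfl⟩ := h₁
  obtain ⟨ψ, hψ, rfl⟩ := h₂
  exact ⟨φ.trans ψ, hφ.trans hψ, image_comp ψ φ A⟩

theorem AmbientIsotopic.symm [CompactSpace X] [T2Space X] {A B : Set X}
    (h : AmbientIsotopic A B) : AmbientIsotopic B A := by
  obtain ⟨φ, hφ, rfl⟩ := h
  exact ⟨φ.symm, hφ.symm, by simp [image_image]⟩

theorem AmbientIsotopic.refl (A : Set X) : AmbientIsotopic A A :=
  ⟨.refl X, ⟨fun _ => .refl X, continuous_snd, rfl, rfl⟩, by simp⟩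

/-- Whether two sets are ambient isotopic may be tested after a homeomorphism, which need not
itself be isotopic to the identity. -/
theorem AmbientIsotopic.of_image {Y : Type*} [TopologicalSpace Y] (e : Y ≃ₜ X) {A B : Set Y}
    (h : AmbientIsotopic (e '' A) (e '' B)) : AmbientIsotopic A B := by
  obtain ⟨φ, hφ, h⟩ := h
  refine ⟨_, hφ.conj e, ?_⟩
  calc _ = e.symm '' (φ '' (e '' A)) := by
        rw [← image_comp, ← image_comp]; rfl
    _ = B := by rw [h]; simp [image_image]

end Isotopy

/-! ### Bands under homeomorphisms -/

theorem bandSurgery_image (φ : Torus ≃ₜ Torus) (C : Set Torus) (β : I × I → Torus) :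
    bandSurgery (φ '' C) (φ ∘ β) = φ '' bandSurgery C β := by
  simp only [bandSurgery, image_union, image_sdiff φ.injective, image_comp]

theorem IsBand.image {C : Set Torus} {β : I × I → Torus} (h : IsBand C β) (φ : Torus ≃ₜ Torus) :
    IsBand (φ '' C) (φ ∘ β) :=
  ⟨φ.continuous.comp h.1, φ.injective.comp h.2.1, by
    rw [preimage_comp, preimage_image_eq _ φ.injective, h.2.2]⟩

/-! ### Torus knots up to isotopy of the torus -/

/-- The displacement of a homeomorphism of the torus that is isotopic to the identity lifts
to the plane, and the lift is bounded. -/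
theorem IsotopicToId.exists_bounded_displacement {φ : Torus ≃ₜ Torus} (hφ : IsotopicToId φ) :
    ∃ d : Torus → ℝ × ℝ, Continuous d ∧ (∀ x, φ x = x + proj (d x).1 (d x).2) ∧
      ∃ B : ℝ, ∀ x, |(d x).1| ≤ B ∧ |(d x).2| ≤ B := by
  obtain ⟨F, hF, hF0, rfl⟩ := hφ
  have cov : IsCoveringMap ((↑) : ℝ → UnitAddCircle) := AddCircle.isCoveringMap_coe 1
  let H₁ : C(I × Torus, UnitAddCircle) := ⟨fun z => (F z.1 z.2 - z.2).1, by fun_prop⟩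
  let H₂ : C(I × Torus, UnitAddCircle) := ⟨fun z => (F z.1 z.2 - z.2).2, by fun_prop⟩
  have h₁ : ∀ a, H₁ (0, a) = (((0 : C(Torus, ℝ)) a : ℝ) : UnitAddCircle) := by simp [H₁, hF0]
  have h₂ : ∀ a, H₂ (0, a) = (((0 : C(Torus, ℝ)) a : ℝ) : UnitAddCircle) := by simp [H₂, hF0]
  let d₁ := cov.liftHomotopy H₁ 0 h₁
  let d₂ := cov.liftHomotopy H₂ 0 h₂
  have e₁ : ∀ x, ((d₁ (1, x) : ℝ) : UnitAddCircle) = (F 1 x - x).1 := fun x =>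
    congr_fun (cov.liftHomotopy_lifts H₁ 0 h₁) (1, x)
  have e₂ : ∀ x, ((d₂ (1, x) : ℝ) : UnitAddCircle) = (F 1 x - x).2 := fun x =>
    congr_fun (cov.liftHomotopy_lifts H₂ 0 h₂) (1, x)
  have hd : Continuous fun x : Torus => (d₁ (1, x), d₂ (1, x)) := by fun_prop
  refine ⟨fun x => (d₁ (1, x), d₂ (1, x)), hd, fun x => ?_, ?_⟩
  · ext
    · simp [proj, e₁]
    · simp [proj, e₂]
  · obtain ⟨B, hB⟩ := (isCompact_range hd).isBounded.exists_norm_le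
    refine ⟨B, fun x => ?_⟩
    have := hB _ (mem_range_self x)
    rw [Prod.norm_def, max_le_iff] at this
    exact this

theorem proj_eq_proj_iff {x y x' y' : ℝ} :
    proj x y = proj x' y' ↔ ∃ m n : ℤ, x = x' + m ∧ y = y' + n := by
  have key : ∀ a b : ℝ, (a : UnitAddCircle) = b ↔ ∃ m : ℤ, a = b + m := fun a b => by
    rw [← sub_eq_zero, ← AddCircle.coe_sub, AddCircle.coe_eq_zero_iff]
    simp only [zsmul_eq_mul, mul_one]
    exact exists_congr fun m => ⟨fun h => by linarith, fun h => by linarith⟩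
  simp only [proj, Prod.mk.injEq, key]
  tauto

theorem proj_surjective (z : Torus) : ∃ x y : ℝ, proj x y = z := by
  obtain ⟨x, y⟩ := z
  obtain ⟨x, rfl⟩ := QuotientAddGroup.mk_surjective x
  obtain ⟨y, rfl⟩ := QuotientAddGroup.mk_surjective y
  exact ⟨x, y, rfl⟩

theorem exists_int_of_proj_mem_T {p q : ℕ} {x y : ℝ} (h : proj x y ∈ T p q) :
    ∃ m : ℤ, q * x - p * y = m := by
  obtain ⟨t, ht⟩ := h
  obtain ⟨m, n, hm, hn⟩ := proj_eq_proj_iff.1 ht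
  refine ⟨p * n - q * m, ?_⟩
  push_cast
  linear_combination (p : ℝ) * hn - (q : ℝ) * hm

/-- An isotopy of the torus does not change the slope of a torus knot: along the lifted curve the
linear form that vanishes on the target line takes integer values, so it is constant, while it
differs by a bounded amount from its values on the source line. -/
theorem slope_eq_of_isotopic {p q p' q' : ℕ} {φ : Torus ≃ₜ Torus} (hφ : IsotopicToId φ)
    (h : φ '' T p q ⊆ T p' q') : p * q' = p' * q := by
  obtain ⟨d, hd, hφd, B, hB⟩ := hφ.exists_bounded_displacement
  let γ : ℝ → Torus := fun t => proj (p * t) (q * t)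
  have hγ : Continuous γ := by
    refine Continuous.prodMk ?_ ?_ <;>
      exact (AddCircle.continuous_mk' 1).comp (continuous_const.mul continuous_id)
  let G : ℝ → ℝ := fun t => q' * (p * t + (d (γ t)).1) - p' * (q * t + (d (γ t)).2)
  have hG : Continuous G := by fun_prop
  have hint : ∀ t, ∃ m : ℤ, G t = m := fun t => by
    apply exists_int_of_proj_mem_T
    convert h ⟨γ t, ⟨t, rfl⟩, rfl⟩ using 1
    rw [hφd]
    simp [γ, proj]
  choose g hg using hint
  have hgc : Continuous g := by
    rw [Int.isClosedEmbedding_coe_real.isInducing.continuous_iff]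
    convert hG using 1
    ext t
    exact (hg t).symm
  have hconst : ∀ t, G t = G 0 := fun t => by
    rw [hg, hg, PreconnectedSpace.constant inferInstance hgc]
  have hbound : ∀ t, |q' * (d (γ t)).1 - p' * (d (γ t)).2| ≤ q' * B + p' * B := fun t => by
    refine (abs_sub _ _).trans (add_le_add ?_ ?_) <;> rw [abs_mul, Nat.abs_cast]
    · exact mul_le_mul_of_nonneg_left (hB _).1 (Nat.cast_nonneg _)
    · exact mul_le_mul_of_nonneg_left (hB _).2 (Nat.cast_nonneg _)
  by_contra hne
  have hs : ((p * q' : ℝ) - p' * q) ≠ 0 := by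
    rw [sub_ne_zero]
    exact_mod_cast hne
  -- A time at which the linear form would have moved by more than twice the bound.
  let t : ℝ := (2 * (q' * B + p' * B) + 1) / ((p * q' : ℝ) - p' * q)
  have ht : ((p * q' : ℝ) - p' * q) * t = 2 * (q' * B + p' * B) + 1 := mul_div_cancel₀ _ hs
  have h0 := abs_le.1 (hbound 0)
  have h1 := abs_le.1 (hbound t)
  have h2 := hconst t
  simp only [G] at h2
  linarith

theorem eq_of_isotopic {p q p' q' : ℕ} (hpq : p.Coprime q) (hpq' : p'.Coprime q')
    {φ : Torus ≃ₜ Torus} (hφ : IsotopicToId φ) (h : φ '' T p q = T p' q') : p = p' ∧ q = q' := by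
  have hs := slope_eq_of_isotopic hφ h.le
  constructor
  · exact Nat.dvd_antisymm (hpq.dvd_of_dvd_mul_right ⟨q', hs.symm⟩)
      (hpq'.dvd_of_dvd_mul_right ⟨q, hs⟩)
  · exact Nat.dvd_antisymm (hpq.symm.dvd_of_dvd_mul_left ⟨p', by linarith⟩)
      (hpq'.symm.dvd_of_dvd_mul_left ⟨p, by linarith⟩)

/-! ### Isotopies that move points along the fibres of the torus -/

theorem isOpenQuotientMap_proj : IsOpenQuotientMap fun z : ℝ × ℝ => proj z.1 z.2 := by
  have h : IsOpenQuotientMap ((↑) : ℝ → UnitAddCircle) :=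
    QuotientAddGroup.isOpenQuotientMap_mk
  exact h.prodMap h

/-- A continuous function of the plane that is periodic under integer translations descends to
the torus. -/
theorem exists_continuous_of_periodic {f : ℝ × ℝ → ℝ} (hf : Continuous f)
    (h₁ : ∀ x y, f (x + 1, y) = f (x, y)) (h₂ : ∀ x y, f (x, y + 1) = f (x, y)) :
    ∃ δ : Torus → ℝ, Continuous δ ∧ ∀ x y, δ (proj x y) = f (x, y) := by
  have h₁' : ∀ (m : ℤ) x y, f (x + m, y) = f (x, y) := fun m x y => by
    have : Function.Periodic (fun x => f (x, y)) 1 := fun x => h₁ x y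
    simpa using this.int_mul m x
  have h₂' : ∀ (m : ℤ) x y, f (x, y + m) = f (x, y) := fun m x y => by
    have : Function.Periodic (fun y => f (x, y)) 1 := fun y => h₂ x y
    simpa using this.int_mul m y
  have hinv : ∀ x y, f (Function.surjInv isOpenQuotientMap_proj.surjective (proj x y)) = f (x, y) :=
    fun x y => by
      have h := Function.surjInv_eq isOpenQuotientMap_proj.surjective (proj x y)
      obtain ⟨m, n, hm, hn⟩ := proj_eq_proj_iff.1 h
      rw [← Prod.mk.eta (p := Function.surjInv _ _), hm, hn, h₁', h₂']
  refine ⟨fun z => f (Function.surjInv isOpenQuotientMap_proj.surjective z), ?_, hinv⟩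
  rw [← isOpenQuotientMap_proj.continuous_comp_iff]
  convert hf using 1
  ext ⟨x, y⟩
  exact hinv x y

/-- Moving every point `(x, y)` of the torus by `δ (x, y)` in its fibre `{x} × ℝ / ℤ` is isotopic
to the identity as long as `y ↦ δ (x, y)` shortens distances. -/
theorem exists_isotopicToId_of_fibre_displacement {δ : Torus → ℝ} (hδ : Continuous δ)
    (hlt : ∀ x y y' : ℝ, y ≠ y' → |δ (proj x y) - δ (proj x y')| < |y - y'|) :
    ∃ φ : Torus ≃ₜ Torus, IsotopicToId φ ∧
      ∀ z : Torus, φ z = (z.1, z.2 + (δ z : UnitAddCircle)) := by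
  let f : I → Torus → Torus := fun s z => (z.1, z.2 + ((s * δ z : ℝ) : UnitAddCircle))
  have hf : Continuous fun z : I × Torus => f z.1 z.2 := by
    have : Continuous fun z : I × Torus => (((z.1 : ℝ) * δ z.2 : ℝ) : UnitAddCircle) :=
      (AddCircle.continuous_mk' 1).comp (by fun_prop)
    fun_prop
  have hproj : ∀ s x y, f s (proj x y) = proj x (y + s * δ (proj x y)) := fun s x y => by
    simp [f, proj]
  have hinj : ∀ s, Function.Injective (f s) := by
    intro s z z' h
    obtain ⟨x, y, rfl⟩ := proj_surjective z
    obtain ⟨x', y', rfl⟩ := proj_surjective z'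
    rw [hproj, hproj] at h
    obtain ⟨m, n, hx, hy⟩ := proj_eq_proj_iff.1 h
    have e : proj x' y' = proj x (y' + n) := proj_eq_proj_iff.2 ⟨-m, -n, by simp [hx], by simp⟩
    rw [e] at hy ⊢
    by_contra hne
    have hne' : y ≠ y' + n := fun h => hne (by rw [h])
    have h1 := hlt x y (y' + n) hne'
    have h2 : y - (y' + n) = -(s * (δ (proj x y) - δ (proj x (y' + n)))) := by linarith
    rw [h2, abs_neg, abs_mul, abs_of_nonneg s.2.1] at h1
    exact absurd h1 (not_lt.2 (mul_le_of_le_one_left (abs_nonneg _) s.2.2))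
  obtain ⟨B, hB⟩ : ∃ B, ∀ z, |δ z| ≤ B := by
    obtain ⟨B, hB⟩ := (isCompact_range hδ).isBounded.exists_norm_le
    exact ⟨B, fun z => hB _ (mem_range_self z)⟩
  have hsurj : ∀ s, Function.Surjective (f s) := by
    intro s z
    obtain ⟨x, y, rfl⟩ := proj_surjective z
    have hc : Continuous fun t : ℝ => t + s * δ (proj x t) := by
      have : Continuous fun t : ℝ => proj x t :=
        continuous_const.prodMk (AddCircle.continuous_mk' 1)
      fun_prop
    have hb : ∀ t, |s * δ (proj x t)| ≤ B := fun t => by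
      rw [abs_mul, abs_of_nonneg s.2.1]
      exact (mul_le_of_le_one_left (abs_nonneg _) s.2.2).trans (hB _)
    have hmem : y ∈ Icc ((y - B) + s * δ (proj x (y - B))) ((y + B) + s * δ (proj x (y + B))) :=
      ⟨by linarith [abs_le.1 (hb (y - B))], by linarith [abs_le.1 (hb (y + B))]⟩
    have hB0 : 0 ≤ B := (abs_nonneg _).trans (hB 0)
    obtain ⟨t, -, ht⟩ := intermediate_value_Icc (by linarith) hc.continuousOn hmem
    exact ⟨proj x t, by rw [hproj]; exact congrArg _ ht⟩
  let F : I → (Torus ≃ₜ Torus) := fun s =>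
    Continuous.homeoOfEquivCompactToT2 (f := Equiv.ofBijective (f s) ⟨hinj s, hsurj s⟩)
      (hf.comp (continuous_const.prodMk continuous_id))
  refine ⟨F 1, ⟨F, hf, ?_, rfl⟩, fun z => ?_⟩
  · ext z
    · rfl
    · change z.2 + ((((0 : I) : ℝ) * δ z : ℝ) : UnitAddCircle) = z.2
      simp
  · change (z.1, z.2 + ((((1 : I) : ℝ) * δ z : ℝ) : UnitAddCircle)) = _
    simp

/-- The shear of the torus along a continuous function of the second coordinate. -/
theorem exists_isotopicToId_shear {g : UnitAddCircle → ℝ} (hg : Continuous g) :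
    ∃ φ : Torus ≃ₜ Torus, IsotopicToId φ ∧
      ∀ z : Torus, φ z = (z.1 + (g z.2 : UnitAddCircle), z.2) := by
  obtain ⟨φ, hφ, h⟩ := exists_isotopicToId_of_fibre_displacement (δ := fun z => g z.1) (by fun_prop)
    (fun x y y' hy => by simpa [proj, sub_eq_zero] using hy)
  refine ⟨_, hφ.conj (Homeomorph.prodComm _ _), fun z => ?_⟩
  simp [h]

theorem isotopicToId_addRight (v : ℝ) :
    ∃ φ : Torus ≃ₜ Torus, IsotopicToId φ ∧ ∀ x y, φ (proj x y) = proj x (y + v) := by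
  obtain ⟨φ, hφ, h⟩ := exists_isotopicToId_of_fibre_displacement (δ := fun _ => v) (by fun_prop)
    (fun x y y' hy => by simpa [sub_eq_zero] using hy)
  exact ⟨φ, hφ, fun x y => by rw [h]; simp [proj]⟩

/-! ### Two-strand graphs -/

theorem norm_add_one_addCircle_two (w : AddCircle (2 : ℝ)) :
    ‖w + ((1 : ℝ) : AddCircle (2 : ℝ))‖ = 1 - ‖w‖ := by
  have h2 : (2 : ℝ) ≠ 0 := two_ne_zero
  have key : ∀ x : ℝ, |x| ≤ 1 → ‖(x : AddCircle (2 : ℝ))‖ = |x| := fun x hx =>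
    (AddCircle.norm_coe_eq_abs_iff (p := 2) h2).2 (by rw [abs_two]; linarith)
  have : Fact (0 < (2 : ℝ)) := ⟨two_pos⟩
  obtain ⟨b, ⟨hb, hb'⟩, rfl⟩ : w ∈ ((↑) : ℝ → AddCircle (2 : ℝ)) '' Ico (-1) (-1 + 2) := by
    rw [AddCircle.coe_image_Ico_eq]; trivial
  rw [key b (abs_le.2 ⟨hb, by linarith⟩), ← AddCircle.coe_add]
  rcases le_total b 0 with h | h
  · rw [key _ (abs_le.2 ⟨by linarith, by linarith⟩), abs_of_nonpos h, abs_of_nonneg (by linarith)]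
    ring
  · have : ((b + 1 : ℝ) : AddCircle (2 : ℝ)) = ((b - 1 : ℝ) : AddCircle (2 : ℝ)) := by
      rw [← AddCircle.coe_add_period 2 (b - 1)]
      congr 1
      ring
    rw [this, key _ (abs_le.2 ⟨by linarith, by linarith⟩), abs_of_nonneg h,
      abs_of_nonpos (by linarith)]
    ring

/-- A closed curve that is the graph of a function `u ↦ k u - u / 2` with `k` of period `2`
runs twice around the first factor of the torus. If its two strands are disjoint, it is isotopic
to the curve with `k = 0`. The isotopy moves the two points over `u` linearly and interpolates
between them with a tent function. -/
theorem ambientIsotopic_two_strand_graph {k : AddCircle (2 : ℝ) → ℝ} (hk : Continuous k)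
    (hlt : ∀ u, |k u - k (u + ((1 : ℝ) : AddCircle (2 : ℝ)))| < 1 / 2) :
    AmbientIsotopic (range fun u : ℝ => proj u (-u / 2))
      (range fun u : ℝ => proj u (k u - u / 2)) := by
  have h2 : ((1 : ℝ) : AddCircle (2 : ℝ)) + ((1 : ℝ) : AddCircle (2 : ℝ)) = 0 := by
    rw [← AddCircle.coe_add, one_add_one_eq_two, AddCircle.coe_period]
  have hc : Continuous ((↑) : ℝ → AddCircle (2 : ℝ)) := AddCircle.continuous_mk' 2
  let one : AddCircle (2 : ℝ) := ((1 : ℝ) : AddCircle (2 : ℝ))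
  -- The displacement in the fibre over `u`: the points of the line are those where `2 y + u` is an
  -- integer, and the displacement is `k u` at the even and `k (u + 1)` at the odd integers. Its
  -- slope in `y` is at most `2 |k u - k (u + 1)| < 1`.
  let f : ℝ × ℝ → ℝ := fun z =>
    k z.1 - (k z.1 - k (z.1 + one)) * ‖((2 * z.2 + z.1 : ℝ) : AddCircle (2 : ℝ))‖
  have hf : Continuous f := by
    have h1 : Continuous fun z : ℝ × ℝ => (z.1 : AddCircle (2 : ℝ)) := hc.comp continuous_fst
    have h2 : Continuous fun z : ℝ × ℝ => ((2 * z.2 + z.1 : ℝ) : AddCircle (2 : ℝ)) :=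
      hc.comp (by fun_prop)
    fun_prop
  obtain ⟨δ, hδ, hδf⟩ := exists_continuous_of_periodic hf
    (fun x y => by
      simp only [f]
      rw [← add_assoc, AddCircle.coe_add, AddCircle.coe_add, norm_add_one_addCircle_two, add_assoc,
        h2, add_zero]
      simp only [one]
      ring)
    (fun x y => by
      simp only [f]
      rw [mul_add, mul_one, add_right_comm, AddCircle.coe_add_period])
  obtain ⟨φ, hφ, hφδ⟩ := exists_isotopicToId_of_fibre_displacement hδ (fun x y y' hy => by
    have hpos : 0 < |y - y'| := abs_pos.2 (sub_ne_zero.2 hy)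
    have hn : |‖((2 * y' + x : ℝ) : AddCircle (2 : ℝ))‖ - ‖((2 * y + x : ℝ) : AddCircle (2 : ℝ))‖|
        ≤ 2 * |y - y'| := by
      refine (abs_norm_sub_norm_le _ _).trans ?_
      rw [← AddCircle.coe_sub]
      refine QuotientAddGroup.norm_mk_le_norm.trans ?_
      rw [Real.norm_eq_abs, abs_sub_comm, show 2 * y + x - (2 * y' + x) = 2 * (y - y') by ring,
        abs_mul, abs_two]
    rw [hδf, hδf]
    calc _ = |k x - k (x + one)| * |‖((2 * y' + x : ℝ) : AddCircle (2 : ℝ))‖ -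
          ‖((2 * y + x : ℝ) : AddCircle (2 : ℝ))‖| := by
            rw [← abs_mul]; congr 1; simp only [f]; ring
      _ ≤ |k x - k (x + one)| * (2 * |y - y'|) := mul_le_mul_of_nonneg_left hn (abs_nonneg _)
      _ < 1 / 2 * (2 * |y - y'|) := mul_lt_mul_of_pos_right (hlt x) (by positivity)
      _ = |y - y'| := by ring)
  refine ⟨φ, hφ, ?_⟩
  rw [← range_comp]
  congr 1
  ext1 u
  have : φ (proj u (-u / 2)) = proj u (-u / 2 + δ (proj u (-u / 2))) := by
    rw [hφδ]; simp [proj]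
  rw [Function.comp_apply, this, hδf]
  have : (2 * (-u / 2) + u : ℝ) = 0 := by ring
  simp only [f, this, AddCircle.coe_zero, norm_zero]
  congr 1
  ring

/-- The graph criterion for a curve that is given over one double turn `[a, a + 2]`. -/
theorem ambientIsotopic_image_graph {h : ℝ → ℝ} {a : ℝ} (hc : Continuous h)
    (hper : h (a + 2) = h a - 1)
    (hlt : ∀ v ∈ Icc a (a + 1), 0 < h v - h (v + 1) ∧ h v - h (v + 1) < 1) :
    AmbientIsotopic (range fun u : ℝ => proj u (-u / 2))
      ((fun v => proj v (h v)) '' Icc a (a + 2)) := by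
  have : Fact (0 < (2 : ℝ)) := ⟨two_pos⟩
  let k₀ : ℝ → ℝ := fun v => h v + v / 2
  let k : AddCircle (2 : ℝ) → ℝ := AddCircle.liftIco 2 a k₀
  have hends : k₀ a = k₀ (a + 2) := by simp only [k₀, hper]; ring
  have hk : Continuous k := AddCircle.liftIco_continuous hends (by fun_prop)
  have hkv : ∀ v ∈ Icc a (a + 2), k v = k₀ v := fun v hv => by
    rcases hv.2.lt_or_eq with h | rfl
    · exact AddCircle.liftIco_coe_apply ⟨hv.1, h⟩
    · rw [AddCircle.coe_add_period, ← hends]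
      exact AddCircle.liftIco_coe_apply ⟨le_rfl, by linarith⟩
  have hrep : ∀ u : AddCircle (2 : ℝ), ∃ v ∈ Ico a (a + 2), (v : AddCircle (2 : ℝ)) = u :=
    fun u => by
      have := mem_univ u
      rwa [← AddCircle.coe_image_Ico_eq 2 a] at this
  have key := ambientIsotopic_two_strand_graph hk (fun u => by
    obtain ⟨v, ⟨h1, h2⟩, rfl⟩ := hrep u
    rw [abs_lt, ← AddCircle.coe_add]
    rcases lt_or_ge v (a + 1) with h3 | h3
    · rw [hkv v ⟨h1, h2.le⟩, hkv (v + 1) ⟨by linarith, by linarith⟩]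
      have := hlt v ⟨h1, h3.le⟩
      simp only [k₀]
      constructor <;> linarith
    · have e : ((v + 1 : ℝ) : AddCircle (2 : ℝ)) = ((v - 1 : ℝ) : AddCircle (2 : ℝ)) := by
        rw [← AddCircle.coe_add_period 2 (v - 1)]
        congr 1
        ring
      rw [e, hkv v ⟨h1, h2.le⟩, hkv (v - 1) ⟨by linarith, by linarith⟩]
      have := hlt (v - 1) ⟨by linarith, by linarith⟩
      rw [sub_add_cancel] at this
      simp only [k₀]
      constructor <;> linarith)
  convert key using 1
  ext z
  constructor
  · rintro ⟨v, hv, rfl⟩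
    exact ⟨v, by simp [hkv v hv, k₀]⟩
  · rintro ⟨u, rfl⟩
    obtain ⟨v, hv, hu⟩ := hrep u
    refine ⟨v, Ico_subset_Icc_self hv, ?_⟩
    have hku : k u = h v + v / 2 := by rw [← hu, hkv v (Ico_subset_Icc_self hv)]
    rw [← sub_eq_zero, ← AddCircle.coe_sub, AddCircle.coe_eq_zero_iff] at hu
    obtain ⟨n, hn⟩ := hu
    rw [zsmul_eq_mul] at hn
    simp only [hku]
    exact proj_eq_proj_iff.2 ⟨2 * n, -n, by push_cast; linarith, by push_cast; linarith⟩

/-! ### Surgery on a meridian circle along a slanted band -/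

/-- The circle `{0} × ℝ / ℤ` on the torus. -/
def verticalCircle : Set Torus := range fun t : ℝ => proj 0 t

/-- The band of height `ε` that starts at `(0, t₀)` and runs once around the first factor of the
torus in the direction `(1, -c)`. -/
def slantedBand (c t₀ ε : ℝ) (z : I × I) : Torus := proj z.1 (t₀ - c * z.1 + z.2 * ε)

/-- The function whose graph over `[ε - c, ε - c + 2]` is the curve obtained from the vertical
circle by surgery along `slantedBand c 0 ε` and then by the shear that moves the two remaining
arcs of the circle in opposite directions. The graph has one linear piece for each of these two
arcs and for each of the two sides of the band. -/
noncomputable def surgeredGraph (c ε v : ℝ) : ℝ :=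
  if v ≤ 0 then v
  else if v ≤ 1 - c then -(c / (1 - c) * v)
  else if v ≤ 1 + ε then -c - (1 - c - ε) / (c + ε) * (v - (1 - c))
  else ε - 1 - c / (1 - c) * (v - 1 - ε)

theorem surgeredGraph_arc_up {c ε v : ℝ} (h : v ≤ 0) : surgeredGraph c ε v = v := if_pos h

theorem surgeredGraph_side_zero {c ε v : ℝ} (h0 : 0 ≤ v) (h1 : v ≤ 1 - c) :
    surgeredGraph c ε v = -(c / (1 - c) * v) := by
  rcases h0.eq_or_lt with rfl | h0
  · simp [surgeredGraph]
  · rw [surgeredGraph, if_neg (not_le.2 h0), if_pos h1]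

theorem surgeredGraph_arc_down {c ε v : ℝ} (hc1 : c < 1) (h0 : 1 - c ≤ v) (h1 : v ≤ 1 + ε) :
    surgeredGraph c ε v = -c - (1 - c - ε) / (c + ε) * (v - (1 - c)) := by
  rcases h0.eq_or_lt with rfl | h0
  · rw [surgeredGraph_side_zero (by linarith) le_rfl, div_mul_cancel₀ _ (by linarith)]
    simp
  · rw [surgeredGraph, if_neg (by linarith), if_neg (not_le.2 h0), if_pos h1]

theorem surgeredGraph_side_one {c ε v : ℝ} (hc : 0 < c) (hc1 : c < 1) (hε : 0 < ε)
    (h0 : 1 + ε ≤ v) :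
    surgeredGraph c ε v = ε - 1 - c / (1 - c) * (v - 1 - ε) := by
  rcases h0.eq_or_lt with rfl | h0
  · have h2 : c + ε ≠ 0 := by linarith
    rw [surgeredGraph_arc_down hc1 (by linarith) le_rfl]
    field_simp
    ring
  · rw [surgeredGraph, if_neg (by linarith), if_neg (by linarith), if_neg (not_le.2 h0)]

theorem continuous_surgeredGraph {c ε : ℝ} (hc : 0 < c) (hc1 : c < 1) (hε : 0 < ε) :
    Continuous (surgeredGraph c ε) := by
  have h1 : 1 - c ≠ 0 := by linarith
  have h2 : c + ε ≠ 0 := by linarith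
  refine Continuous.if_le (by fun_prop) ?_ continuous_id continuous_const ?_
  · refine Continuous.if_le (by fun_prop) ?_ continuous_id continuous_const ?_
    · refine Continuous.if_le (by fun_prop) (by fun_prop) continuous_id continuous_const ?_
      rintro v rfl
      field_simp
      ring
    · rintro v rfl
      rw [if_pos (by linarith)]
      field_simp
      ring
  · rintro v rfl
    rw [if_pos (by linarith)]
    simp

theorem surgeredGraph_strands {c ε v : ℝ} (hε : 0 < ε) (hεc : ε < c) (hc : c ≤ 1 / 2)
    (hv : v ∈ Icc (ε - c) (ε - c + 1)) :
    0 < surgeredGraph c ε v - surgeredGraph c ε (v + 1) ∧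
      surgeredGraph c ε v - surgeredGraph c ε (v + 1) < 1 := by
  obtain ⟨hv1, hv2⟩ := hv
  have hc0 : 0 < c := hε.trans hεc
  have hc1 : c < 1 := by linarith
  have hκ : c / (1 - c) * (1 - c) = c := div_mul_cancel₀ _ (by linarith)
  have hm : (1 - c - ε) / (c + ε) * (c + ε) = 1 - c - ε := div_mul_cancel₀ _ (by linarith)
  have hκ0 : 0 < c / (1 - c) := div_pos (by linarith) (by linarith)
  have hm0 : 0 < (1 - c - ε) / (c + ε) := div_pos (by linarith) (by linarith)
  have up := @surgeredGraph_arc_up c ε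
  have side_zero := @surgeredGraph_side_zero c ε
  have down := @surgeredGraph_arc_down c ε
  have side_one := @surgeredGraph_side_one c ε
  generalize c / (1 - c) = κ at *
  generalize (1 - c - ε) / (c + ε) = m at *
  have h1 : 0 < (1 + κ) * ε := by positivity
  have h2 : (1 + κ) * ε < 1 := by nlinarith
  have h3 : 0 < (1 + m) * ε := by positivity
  have h4 : (1 + m) * ε < 1 := by nlinarith
  have h5 : (1 + m) * c < 1 := by nlinarith
  have h6 : 0 < (1 + m) * c := by positivity
  -- In each of the four cases both terms are affine in `v`.
  rcases le_total v 0 with h | h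
  · rw [up h, down (v := v + 1) hc1 (by linarith) (by linarith)]
    constructor <;> nlinarith
  rcases le_total v ε with h' | h'
  · rw [side_zero h (by linarith), down (v := v + 1) hc1 (by linarith) (by linarith)]
    rcases le_total m κ with hle | hle
    · constructor <;> nlinarith
    · constructor <;> nlinarith
  rcases le_total v (1 - c) with h'' | h''
  · rw [side_zero h h'', side_one (v := v + 1) hc0 hc1 hε (by linarith)]
    constructor <;> nlinarith
  · rw [down (v := v) hc1 h'' (by linarith), side_one (v := v + 1) hc0 hc1 hε (by linarith)]
    rcases le_total m κ with hle | hle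
    · constructor <;> nlinarith
    · constructor <;> nlinarith

theorem bandSurgery_slantedBand {c ε : ℝ} (hε : 0 < ε) (hεc : ε < c) (hc : c ≤ 1 / 2) :
    bandSurgery verticalCircle (slantedBand c 0 ε) =
      proj 0 '' Icc (ε - c) 0 ∪ proj 0 '' Icc ε (1 - c) ∪
        ((fun s => proj s (-(c * s))) '' Icc 0 1 ∪ (fun s => proj s (ε - c * s)) '' Icc 0 1) := by
  have hint : ∀ (n : ℤ) (x : ℝ), x = n → -1 < x → x < 1 → x = 0 := fun n x h h1 h2 => by
    rw [h] at h1 h2 ⊢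
    have h1 : -1 < n := by exact_mod_cast h1
    have h2 : n < 1 := by exact_mod_cast h2
    rw [show n = 0 by lia, Int.cast_zero]
  have mem_surgery : ∀ y, (∀ r ∈ Ioo (0 : ℝ) 1, (∀ n : ℤ, y ≠ ε * r + n) ∧
      ∀ n : ℤ, y ≠ ε * r - c + n) → proj 0 y ∈ bandSurgery verticalCircle (slantedBand c 0 ε) := by
    refine fun y hy => Or.inl ⟨⟨y, rfl⟩, ?_⟩
    rintro ⟨⟨s, r⟩, ⟨hs, hr0, hr1⟩, h⟩
    obtain ⟨-, n, -, hn⟩ := proj_eq_proj_iff.1 h.symm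
    have hr : (r : ℝ) ∈ Ioo (0 : ℝ) 1 := ⟨unitInterval.pos_iff_ne_zero.2 hr0,
      unitInterval.lt_one_iff_ne_one.2 hr1⟩
    rcases hs with hs | hs
    · refine (hy r hr).1 n ?_
      simp only at hs
      rw [hn, hs]; simp; ring
    · refine (hy r hr).2 n ?_
      simp only at hs
      rw [hn, hs]; simp; ring
  have not_mem : ∀ y s r : ℝ, (s = 0 ∨ s = 1) → r ∈ Ioo (0 : ℝ) 1 → y = ε * r - c * s →
      proj 0 y ∈ slantedBand c 0 ε '' {z | (z.1 = 0 ∨ z.1 = 1) ∧ z.2 ≠ 0 ∧ z.2 ≠ 1} := by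
    intro y s r hs hr hy
    have hs' : s ∈ Icc (0 : ℝ) 1 := by rcases hs with rfl | rfl <;> simp
    refine ⟨(⟨s, hs'⟩, ⟨r, hr.1.le, hr.2.le⟩), ⟨?_, ?_, ?_⟩, ?_⟩
    · rcases hs with rfl | rfl
      · exact Or.inl rfl
      · exact Or.inr rfl
    · exact fun h => hr.1.ne' (congrArg Subtype.val h)
    · exact fun h => hr.2.ne (congrArg Subtype.val h)
    · rcases hs with rfl | rfl
      · exact proj_eq_proj_iff.2 ⟨0, 0, by simp, by simp [hy]; ring⟩
      · exact proj_eq_proj_iff.2 ⟨1, 0, by simp, by simp [hy]; ring⟩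
  ext z
  constructor
  · rintro (⟨⟨y, rfl⟩, hy⟩ | ⟨⟨s, r⟩, hr | hr, rfl⟩)
    · have hrep : (y : UnitAddCircle) ∈ ((↑) : ℝ → UnitAddCircle) '' Ico (-c) (-c + 1) := by
        rw [AddCircle.coe_image_Ico_eq]; trivial
      obtain ⟨y', ⟨h1, h2⟩, he⟩ := hrep
      have e : proj 0 y = proj 0 y' := Prod.ext rfl he.symm
      simp only [e] at hy ⊢
      rcases h1.eq_or_lt with h1 | h1
      · refine Or.inr (Or.inl ⟨1, by simp, proj_eq_proj_iff.2 ⟨1, 0, by simp, by simp [← h1]⟩⟩)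
      rcases lt_or_ge y' (ε - c) with h3 | h3
      · refine absurd (not_mem y' 1 ((y' + c) / ε) (Or.inr rfl) ⟨?_, ?_⟩ ?_) hy
        · exact div_pos (by linarith) hε
        · rw [div_lt_one hε]; linarith
        · field_simp; ring
      rcases le_or_gt y' 0 with h4 | h4
      · exact Or.inl (Or.inl ⟨y', ⟨h3, h4⟩, rfl⟩)
      rcases lt_or_ge y' ε with h5 | h5
      · refine absurd (not_mem y' 0 (y' / ε) (Or.inl rfl) ⟨?_, ?_⟩ ?_) hy
        · exact div_pos h4 hε
        · rwa [div_lt_one hε]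
        · field_simp; ring
      · exact Or.inl (Or.inr ⟨y', ⟨h5, by linarith⟩, rfl⟩)
    · simp only at hr
      exact Or.inr (Or.inl ⟨s, s.2, by simp [slantedBand, hr]⟩)
    · simp only at hr
      exact Or.inr (Or.inr ⟨s, s.2, by simp [slantedBand, hr]; congr 1; ring⟩)
  · rintro ((⟨y, ⟨h1, h2⟩, rfl⟩ | ⟨y, ⟨h1, h2⟩, rfl⟩) | (⟨s, hs, rfl⟩ | ⟨s, hs, rfl⟩))
    · refine mem_surgery y fun r ⟨hr0, hr1⟩ => ⟨fun n hn => ?_, fun n hn => ?_⟩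
      · have := hint n (y - ε * r) (by linarith) (by nlinarith) (by nlinarith)
        nlinarith
      · have := hint n (y - ε * r + c) (by linarith) (by nlinarith) (by nlinarith)
        nlinarith
    · refine mem_surgery y fun r ⟨hr0, hr1⟩ => ⟨fun n hn => ?_, fun n hn => ?_⟩
      · have := hint n (y - ε * r) (by linarith) (by nlinarith) (by nlinarith)
        nlinarith
      · have := hint n (y - ε * r + c) (by linarith) (by nlinarith) (by nlinarith)
        nlinarith
    · exact Or.inr ⟨(⟨s, hs⟩, 0), Or.inl rfl, by simp [slantedBand]⟩
    · exact Or.inr ⟨(⟨s, hs⟩, 1), Or.inr rfl, by simp [slantedBand]; congr 1; ring⟩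

theorem ambientIsotopic_bandSurgery_slantedBand_zero {c ε : ℝ} (hε : 0 < ε) (hεc : ε < c)
    (hc : c ≤ 1 / 2) :
    AmbientIsotopic (range fun u : ℝ => proj u (-u / 2))
      (bandSurgery verticalCircle (slantedBand c 0 ε)) := by
  have hc0 : 0 < c := hε.trans hεc
  have n1 : 1 - c ≠ 0 := by linarith
  have n2 : c + ε ≠ 0 := by linarith
  have n3 : 1 - c - ε ≠ 0 := by linarith
  -- The shear: its slope is `1` along one arc of the circle that survives, negative along the
  -- other, and `1 < 1 / c` along the sides of the band.
  let g₀ : ℝ → ℝ := fun y => if y ≤ ε then y else ε - (c + ε) / (1 - c - ε) * (y - ε)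
  have hg₀ : Continuous g₀ :=
    Continuous.if_le (by fun_prop) (by fun_prop) continuous_id continuous_const
      (by rintro y rfl; simp)
  have hends : g₀ (-c) = g₀ (-c + 1) := by
    simp only [g₀]
    rw [if_pos (by linarith), if_neg (by linarith)]
    field_simp
    ring
  let g : UnitAddCircle → ℝ := AddCircle.liftIco 1 (-c) g₀
  have hg : ∀ y ∈ Icc (-c) (-c + 1), g y = g₀ y := fun y hy => by
    rcases hy.2.lt_or_eq with h | rfl
    · exact AddCircle.liftIco_coe_apply ⟨hy.1, h⟩
    · rw [AddCircle.coe_add_period, ← hends]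
      exact AddCircle.liftIco_coe_apply ⟨le_rfl, by linarith⟩
  obtain ⟨ψ, hψ, hψg⟩ :=
    exists_isotopicToId_shear (g := g) (AddCircle.liftIco_continuous hends hg₀.continuousOn)
  have low : ∀ x y, -c ≤ y → y ≤ ε → ψ (proj x y) = proj (x + y) y := fun x y h1 h2 => by
    have : g y = y := by rw [hg y ⟨h1, by linarith⟩]; exact if_pos h2
    rw [hψg]
    simp [proj, this]
  have high : ∀ x y, ε ≤ y → y ≤ 1 - c →
      ψ (proj x y) = proj (x + (ε - (c + ε) / (1 - c - ε) * (y - ε))) y := fun x y h1 h2 => by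
    have : g y = ε - (c + ε) / (1 - c - ε) * (y - ε) := by
      rw [hg y ⟨by linarith, by linarith⟩]
      rcases h1.eq_or_lt with rfl | h1
      · simp [g₀]
      · exact if_neg (not_le.2 h1)
    rw [hψg]
    simp [proj, this]
  have key := ambientIsotopic_image_graph (a := ε - c)
    (continuous_surgeredGraph hc0 (by linarith) hε) ?_
    (fun v hv => surgeredGraph_strands hε hεc hc hv)
  · refine key.trans (AmbientIsotopic.symm ⟨ψ, hψ, ?_⟩)
    rw [bandSurgery_slantedBand hε hεc hc]
    ext z
    constructor
    · rintro ⟨_, (⟨y, ⟨h1, h2⟩, rfl⟩ | ⟨y, ⟨h1, h2⟩, rfl⟩) |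
        (⟨s, ⟨h1, h2⟩, rfl⟩ | ⟨s, ⟨h1, h2⟩, rfl⟩), rfl⟩
      · rw [low _ _ (by linarith) (by linarith)]
        exact ⟨y, ⟨h1, by linarith⟩, by simp [surgeredGraph_arc_up h2]⟩
      · rw [high _ _ h1 h2]
        have h3 : (c + ε) / (1 - c - ε) * (y - ε) ≤ c + ε := by
          rw [div_mul_eq_mul_div, div_le_iff₀ (by linarith)]
          nlinarith
        have h4 : 0 ≤ (c + ε) / (1 - c - ε) * (y - ε) :=
          mul_nonneg (div_nonneg (by linarith) (by linarith)) (by linarith)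
        refine ⟨1 + (ε - (c + ε) / (1 - c - ε) * (y - ε)), ⟨by linarith, by linarith⟩, ?_⟩
        simp only
        rw [surgeredGraph_arc_down (by linarith) (by linarith) (by linarith)]
        refine proj_eq_proj_iff.2 ⟨1, -1, by push_cast; ring, ?_⟩
        push_cast
        field_simp
        ring
      · rw [low _ _ (by nlinarith) (by nlinarith)]
        refine ⟨(1 - c) * s, ⟨by nlinarith, by nlinarith⟩, ?_⟩
        simp only
        rw [surgeredGraph_side_zero (by nlinarith) (by nlinarith)]
        congr 1
        · ring
        · field_simp
      · rw [low _ _ (by nlinarith) (by nlinarith)]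
        refine ⟨1 + ε + (1 - c) * s, ⟨by nlinarith, by nlinarith⟩, ?_⟩
        simp only
        rw [surgeredGraph_side_one hc0 (by linarith) hε (by nlinarith)]
        refine proj_eq_proj_iff.2 ⟨1, -1, by push_cast; ring, ?_⟩
        push_cast
        field_simp
        ring
    · rintro ⟨v, ⟨h1, h2⟩, rfl⟩
      simp only
      rcases le_total v 0 with h3 | h3
      · refine ⟨proj 0 v, Or.inl (Or.inl ⟨v, ⟨h1, h3⟩, rfl⟩), ?_⟩
        rw [low _ _ (by linarith) (by linarith), surgeredGraph_arc_up h3, zero_add]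
      rcases le_total v (1 - c) with h4 | h4
      · have hv : v / (1 - c) ≤ 1 := by rw [div_le_one (by linarith)]; exact h4
        have hv0 : 0 ≤ v / (1 - c) := div_nonneg h3 (by linarith)
        refine ⟨_, Or.inr (Or.inl ⟨v / (1 - c), ⟨hv0, hv⟩, rfl⟩), ?_⟩
        rw [low _ _ (by nlinarith) (by nlinarith), surgeredGraph_side_zero h3 h4]
        congr 1 <;> field_simp
        ring
      rcases le_total v (1 + ε) with h5 | h5
      · -- The height of the point, up to an integer.
        let y : ℝ := 1 - c - (1 - c - ε) / (c + ε) * (v - (1 - c))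
        have hy1 : y ≤ 1 - c :=
          sub_le_self _ (mul_nonneg (div_nonneg (by linarith) (by linarith)) (by linarith))
        have hy0 : ε ≤ y := by
          have : (1 - c - ε) / (c + ε) * (v - (1 - c)) ≤ 1 - c - ε := by
            rw [div_mul_eq_mul_div, div_le_iff₀ (by linarith)]
            nlinarith
          linarith
        refine ⟨_, Or.inl (Or.inr ⟨y, ⟨hy0, hy1⟩, rfl⟩), ?_⟩
        rw [high _ _ hy0 hy1, surgeredGraph_arc_down (by linarith) h4 h5]
        refine proj_eq_proj_iff.2 ⟨-1, 1, ?_, by push_cast; ring⟩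
        simp only [y]
        push_cast
        field_simp
        ring
      · let s : ℝ := (v - 1 - ε) / (1 - c)
        have hs1 : s ≤ 1 := by rw [div_le_one (by linarith)]; linarith
        have hs0 : 0 ≤ s := div_nonneg (by linarith) (by linarith)
        refine ⟨_, Or.inr (Or.inr ⟨s, ⟨hs0, hs1⟩, rfl⟩), ?_⟩
        rw [low _ _ (by nlinarith) (by nlinarith), surgeredGraph_side_one hc0 (by linarith) hε h5]
        refine proj_eq_proj_iff.2 ⟨-1, 1, ?_, ?_⟩
        · simp only [s]
          push_cast
          field_simp
          ring
        · simp only [s]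
          push_cast
          field_simp
          ring
  · rw [surgeredGraph_arc_up (v := ε - c) (by linarith),
      surgeredGraph_side_one hc0 (by linarith) hε (by linarith)]
    field_simp
    ring

theorem ambientIsotopic_bandSurgery_slantedBand {c t₀ ε : ℝ} (hε : 0 < ε) (hεc : ε < c)
    (hc : c ≤ 1 / 2) :
    AmbientIsotopic (range fun u : ℝ => proj u (-u / 2))
      (bandSurgery verticalCircle (slantedBand c t₀ ε)) := by
  obtain ⟨φ, hφ, h⟩ := isotopicToId_addRight t₀
  refine (ambientIsotopic_bandSurgery_slantedBand_zero hε hεc hc).trans ⟨φ, hφ, ?_⟩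
  have h1 : φ '' verticalCircle = verticalCircle := by
    rw [verticalCircle, ← range_comp]
    ext z
    constructor
    · rintro ⟨t, rfl⟩
      exact ⟨t + t₀, (h 0 t).symm⟩
    · rintro ⟨t, rfl⟩
      exact ⟨t - t₀, by simp [h]⟩
  have h2 : φ ∘ slantedBand c 0 ε = slantedBand c t₀ ε := by
    ext1 z
    simp only [Function.comp_apply, slantedBand, h]
    congr 1
    ring
  rw [← bandSurgery_image, h1, h2]

/-! ### Pinch moves on the torus knots `T(p, k p + 1)` -/

/-- The linear automorphism `(x, y) ↦ ((k p + 1) x - p y, y - k x)` of the torus, which carries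
`T(p, k p + 1)` to the vertical circle. -/
def straightenKnot (k p : ℕ) : Torus ≃ₜ Torus where
  toFun z := ((k * p + 1) • z.1 - p • z.2, z.2 - k • z.1)
  invFun z := (z.1 + p • z.2, k • z.1 + (k * p + 1) • z.2)
  left_inv z := by ext <;> simp only <;> module
  right_inv z := by ext <;> simp only <;> module
  continuous_toFun := by fun_prop
  continuous_invFun := by fun_prop

theorem straightenKnot_proj (k p : ℕ) (x y : ℝ) :
    straightenKnot k p (proj x y) = proj ((k * p + 1) * x - p * y) (y - k * x) := by
  have h : ∀ (n : ℕ) (x : ℝ), n • (x : UnitAddCircle) = ((n * x : ℝ) : UnitAddCircle) :=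
    fun n x => by rw [← AddCircle.coe_nsmul, nsmul_eq_mul]
  change (_, _) = (_, _)
  simp only [h, ← AddCircle.coe_sub, proj]
  push_cast
  rfl

theorem straightenKnot_image_T (k p : ℕ) :
    straightenKnot k p '' T p (k * p + 1) = verticalCircle := by
  rw [T, ← range_comp, verticalCircle]
  congr 1
  ext1 t
  rw [Function.comp_apply, straightenKnot_proj]
  push_cast
  congr 1 <;> ring

theorem straightenKnot_image_T_pinched (k p : ℕ) :
    straightenKnot k (p + 2) '' T p (k * p + 1) = range fun u : ℝ => proj u (-u / 2) := by
  have h : ∀ t : ℝ, straightenKnot k (p + 2) (proj (p * t) ((k * p + 1 : ℕ) * t)) =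
      proj (-2 * t) t := fun t => by
    rw [straightenKnot_proj]
    push_cast
    congr 1 <;> ring
  rw [T, ← range_comp]
  ext z
  constructor
  · rintro ⟨t, rfl⟩
    refine ⟨-2 * t, ?_⟩
    rw [Function.comp_apply, h]
    exact congrArg _ (by ring)
  · rintro ⟨u, rfl⟩
    refine ⟨-u / 2, ?_⟩
    rw [Function.comp_apply, h]
    ring_nf

theorem straightenKnot_comp_straightBand {k p : ℕ} {t₀ ε a b : ℝ}
    (h : (k * p + 1 : ℕ) * a + p * b = 1) :
    straightenKnot k p ∘ straightBand p (k * p + 1) t₀ ε a b = slantedBand (b + k * a) t₀ ε := by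
  ext1 z
  rw [Function.comp_apply, straightBand, straightenKnot_proj, slantedBand]
  push_cast at h ⊢
  congr 1
  · linear_combination (z.1 : ℝ) * h
  · ring

/-- The two ends of an embedded band that runs from one strand to the next are disjoint. -/
theorem lt_of_injective_slantedBand {c t₀ ε : ℝ} (hc : 0 < c) (hε : 0 < ε)
    (h : Function.Injective (slantedBand c t₀ ε)) : ε < c := by
  by_contra hle
  have hr : c / ε ∈ I := ⟨by positivity, (div_le_one hε).2 (not_lt.1 hle)⟩
  have := @h (0, 0) (1, ⟨c / ε, hr⟩) (proj_eq_proj_iff.2 ⟨-1, 0, by simp, by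
    simp [div_mul_cancel₀ _ hε.ne']⟩)
  exact zero_ne_one (congrArg Prod.fst this)

/-- A pinch move changes `T(p + 2, k (p + 2) + 1)` into `T(p, k p + 1)`. -/
theorem ambientIsotopic_bandSurgery_straightPinchBand {k p : ℕ} (hk : 1 ≤ k)
    {β : I × I → Torus} (hβ : IsStraightPinchBand (p + 2) (k * (p + 2) + 1) β) :
    AmbientIsotopic (T p (k * p + 1)) (bandSurgery (T (p + 2) (k * (p + 2) + 1)) β) := by
  obtain ⟨hband, t₀, ε, a, b, hε, ha, hb, hab, rfl⟩ := hβ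
  refine .of_image (straightenKnot k (p + 2)) ?_
  have hcomp := straightenKnot_comp_straightBand (t₀ := t₀) (ε := ε) hab
  rw [straightenKnot_image_T_pinched, ← bandSurgery_image, hcomp, straightenKnot_image_T]
  have hk' : (1 : ℝ) ≤ k := by exact_mod_cast hk
  have hp : (0 : ℝ) ≤ p := Nat.cast_nonneg p
  push_cast at hab
  have hc1 : (p + 2) * (b + k * a) = 1 - a := by linear_combination hab
  have hc2 : b + k * a ≤ 1 / 2 := by nlinarith [mul_nonneg hp (by positivity : 0 ≤ b + k * a)]
  have hc0 : 0 < b + k * a := by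
    by_contra hle
    have h0 : b + k * a = 0 := le_antisymm (not_lt.1 hle) (by positivity)
    rw [h0] at hc1
    nlinarith
  have hinj := (hband.image (straightenKnot k (p + 2))).2.1
  rw [hcomp] at hinj
  exact ambientIsotopic_bandSurgery_slantedBand hε (lt_of_injective_slantedBand hc0 hε hinj) hc2

theorem isBand_slantedBand {c ε : ℝ} (hε : 0 < ε) (hεc : ε < c) (hc : c ≤ 1 / 2) :
    IsBand verticalCircle (slantedBand c 0 ε) := by
  refine ⟨?_, ?_, ?_⟩
  · exact isOpenQuotientMap_proj.continuous.comp
      (f := fun z : I × I => ((z.1 : ℝ), (0 - c * z.1 + z.2 * ε : ℝ))) (by fun_prop)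
  · rintro ⟨⟨s, hs0, hs1⟩, ⟨r, hr0, hr1⟩⟩ ⟨⟨s', hs0', hs1'⟩, ⟨r', hr0', hr1'⟩⟩ h
    obtain ⟨m, n, hm, hn⟩ := proj_eq_proj_iff.1 h
    simp only at hm hn
    have hrε : r * ε ≤ ε ∧ 0 ≤ r * ε := ⟨by nlinarith, by positivity⟩
    have hrε' : r' * ε ≤ ε ∧ 0 ≤ r' * ε := ⟨by nlinarith, by positivity⟩
    have hm1 : m < 2 := by exact_mod_cast (by linarith : (m : ℝ) < 2)
    have hm2 : -2 < m := by exact_mod_cast (by linarith : (-2 : ℝ) < m)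
    obtain rfl | rfl | rfl : m = 0 ∨ m = 1 ∨ m = -1 := by lia
    · obtain rfl : s = s' := by simpa using hm
      have hn1 : n < 1 := by exact_mod_cast (by linarith : (n : ℝ) < 1)
      have hn2 : -1 < n := by exact_mod_cast (by linarith : (-1 : ℝ) < n)
      obtain rfl : n = 0 := by lia
      obtain rfl : r = r' := mul_right_cancel₀ hε.ne' (by push_cast at hn; linarith)
      rfl
    · push_cast at hm
      rw [show s = 1 by linarith, show s' = 0 by linarith] at hn
      have hn1 : n < 0 := by exact_mod_cast (by linarith : (n : ℝ) < 0)
      have hn2 : -1 < n := by exact_mod_cast (by linarith : (-1 : ℝ) < n)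
      lia
    · push_cast at hm
      rw [show s = 0 by linarith, show s' = 1 by linarith] at hn
      have hn1 : n < 1 := by exact_mod_cast (by linarith : (n : ℝ) < 1)
      have hn2 : 0 < n := by exact_mod_cast (by linarith : (0 : ℝ) < n)
      lia
  · ext ⟨⟨s, hs0, hs1⟩, r⟩
    constructor
    · rintro ⟨t, ht⟩
      obtain ⟨m, -, hm, -⟩ := proj_eq_proj_iff.1 ht
      simp only at hm
      have hm1 : m < 1 := by exact_mod_cast (by linarith : (m : ℝ) < 1)
      have hm2 : -2 < m := by exact_mod_cast (by linarith : (-2 : ℝ) < m)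
      obtain rfl | rfl : m = 0 ∨ m = -1 := by lia
      · exact Or.inl (Subtype.ext (by push_cast at hm; change s = 0; linarith))
      · exact Or.inr (Subtype.ext (by push_cast at hm; change s = 1; linarith))
    · intro h
      refine ⟨0 - c * s + r * ε, ?_⟩
      rcases h with h | h
      · have : s = 0 := congrArg Subtype.val h
        exact proj_eq_proj_iff.2 ⟨0, 0, by simp [this], by simp⟩
      · have : s = 1 := congrArg Subtype.val h
        exact proj_eq_proj_iff.2 ⟨-1, 0, by simp [this], by simp⟩

theorem exists_isStraightPinchBand (k p : ℕ) :
    ∃ β, IsStraightPinchBand (p + 2) (k * (p + 2) + 1) β := by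
  have hp : (0 : ℝ) < p + 2 := by positivity
  have hab : ((k * (p + 2) + 1 : ℕ) : ℝ) * 0 + ((p + 2 : ℕ) : ℝ) * (1 / (p + 2)) = 1 := by
    push_cast
    field_simp
    ring
  refine ⟨_, ?_, 0, 1 / (p + 2) / 2, 0, 1 / (p + 2), by positivity, le_rfl, by positivity, hab, rfl⟩
  have h := (isBand_slantedBand (c := 1 / (p + 2 : ℝ)) (ε := 1 / (p + 2) / 2) (by positivity)
    (half_lt_self (by positivity)) ?_).image (straightenKnot k (p + 2)).symm
  · have hcomp := straightenKnot_comp_straightBand (t₀ := 0) (ε := 1 / (p + 2) / 2) hab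
    rw [mul_zero, add_zero] at hcomp
    rw [← straightenKnot_image_T k (p + 2), ← hcomp] at h
    convert h using 1
    · simp [image_image]
    · ext1 z
      simp
  · rw [div_le_div_iff_of_pos_left one_pos hp two_pos]
    have : (0 : ℝ) ≤ p := Nat.cast_nonneg p
    linarith

theorem coprime_mul_add_one (k p : ℕ) : Nat.Coprime p (k * p + 1) := by simp

/-- Every pinch move on a curve isotopic to `T(p + 2, k (p + 2) + 1)` yields a curve isotopic to
`T(p, k p + 1)`, whichever standard position the move refers to, since isotopies preserve
slopes. -/
theorem IsPinchMove.ambientIsotopic_T {k p : ℕ} (hk : 1 ≤ k) {C C' : Set Torus}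
    (hC : AmbientIsotopic (T (p + 2) (k * (p + 2) + 1)) C) (h : IsPinchMove C C') :
    AmbientIsotopic (T p (k * p + 1)) C' := by
  obtain ⟨ψ, hψ, rfl⟩ := hC
  obtain ⟨_, ⟨p', q', -, -, hpq, φ, hφ, hφT, β, hβ, rfl⟩, rfl⟩ := h
  obtain ⟨rfl, rfl⟩ : p' = p + 2 ∧ q' = k * (p + 2) + 1 :=
    eq_of_isotopic hpq (coprime_mul_add_one _ _) (hφ.trans hψ.symm) (by
      change (fun z => ψ.symm (φ z)) '' _ = _
      rw [← image_image, hφT, image_image]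
      simp)
  rw [← hφT, bandSurgery_image]
  exact (ambientIsotopic_bandSurgery_straightPinchBand hk hβ).trans ⟨φ, hφ, rfl⟩

theorem exists_isPinchMove {k p : ℕ} (hk : 1 ≤ k) {C : Set Torus}
    (hC : AmbientIsotopic (T (p + 2) (k * (p + 2) + 1)) C) : ∃ C', IsPinchMove C C' := by
  obtain ⟨φ, hφ, h⟩ := hC
  obtain ⟨β, hβ⟩ := exists_isStraightPinchBand k p
  exact ⟨_, _, ⟨p + 2, k * (p + 2) + 1, by lia, by nlinarith, coprime_mul_add_one _ _, φ, hφ, h,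
    β, hβ, rfl⟩, rfl⟩

/-! ### Extending isotopies of the torus to the 3-sphere -/

/-- The argument of a complex number as a point of `ℝ / ℤ`, with the value `0` at `0`. -/
noncomputable def polarAngle (w : ℂ) : UnitAddCircle :=
  (AddCircle.homeomorphCircle one_ne_zero).symm (Circle.exp w.arg)

theorem toCircle_polarAngle (w : ℂ) : AddCircle.toCircle (polarAngle w) = Circle.exp w.arg := by
  rw [← AddCircle.homeomorphCircle_apply one_ne_zero, polarAngle, Homeomorph.apply_symm_apply]

theorem norm_mul_toCircle_polarAngle (w : ℂ) :
    (‖w‖ : ℂ) * (AddCircle.toCircle (polarAngle w) : ℂ) = w := by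
  rw [toCircle_polarAngle, Circle.coe_exp, Complex.norm_mul_exp_arg_mul_I]

theorem polarAngle_mul_toCircle {r : ℝ} (hr : 0 < r) (θ : UnitAddCircle) :
    polarAngle (r * (AddCircle.toCircle θ : ℂ)) = θ := by
  apply AddCircle.injective_toCircle one_ne_zero
  have h := norm_mul_toCircle_polarAngle (r * (AddCircle.toCircle θ : ℂ))
  rw [norm_mul, Circle.norm_coe, mul_one, Complex.norm_of_nonneg hr.le] at h
  exact Circle.ext (mul_left_cancel₀ (Complex.ofReal_ne_zero.2 hr.ne') h)

theorem continuousAt_polarAngle {w : ℂ} (hw : w ≠ 0) : ContinuousAt polarAngle w := by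
  refine (Homeomorph.continuous _).continuousAt.comp ?_
  have hi : IsInducing fun z : Circle => (z : ℂ) := ⟨rfl⟩
  rw [hi.continuousAt_iff]
  have h : ContinuousAt (fun w : ℂ => w / ‖w‖) w :=
    continuousAt_id.div (by fun_prop) (by simpa using hw)
  refine h.congr ?_
  filter_upwards [eventually_ne_nhds hw] with v hv
  rw [Function.comp_apply, ← toCircle_polarAngle]
  conv_lhs => rw [← norm_mul_toCircle_polarAngle v]
  rw [norm_mul, Circle.norm_coe, mul_one, Complex.norm_real, norm_norm, mul_div_cancel_left₀]
  simpa using hv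

/-- The arguments of the two complex coordinates of a point of the 3-sphere. -/
noncomputable def angles (z : S3) : Torus := (polarAngle (z.1 0), polarAngle (z.1 1))

theorem sq_add_sq_eq_one (z : S3) : ‖z.1 0‖ ^ 2 + ‖z.1 1‖ ^ 2 = 1 := by
  have h := mem_sphere_zero_iff_norm.1 z.2
  rw [EuclideanSpace.norm_eq, Real.sqrt_eq_one, Fin.sum_univ_two] at h
  exact h

/-- The point of the 3-sphere with the arguments `x` whose coordinates have the same absolute
values as those of `z`. -/
noncomputable def withAngles (z : S3) (x : Torus) : S3 :=
  ⟨!₂[(‖z.1 0‖ : ℂ) * (AddCircle.toCircle x.1 : ℂ),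
      (‖z.1 1‖ : ℂ) * (AddCircle.toCircle x.2 : ℂ)], by
    rw [mem_sphere_zero_iff_norm, EuclideanSpace.norm_eq, Real.sqrt_eq_one, Fin.sum_univ_two]
    change ‖(‖z.1 0‖ : ℂ) * (AddCircle.toCircle x.1 : ℂ)‖ ^ 2 +
      ‖(‖z.1 1‖ : ℂ) * (AddCircle.toCircle x.2 : ℂ)‖ ^ 2 = 1
    rw [norm_mul, norm_mul, Circle.norm_coe, Circle.norm_coe, mul_one, mul_one, Complex.norm_real,
      Complex.norm_real, norm_norm, norm_norm, sq_add_sq_eq_one]⟩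

theorem norm_withAngles_zero (z : S3) (x : Torus) : ‖(withAngles z x).1 0‖ = ‖z.1 0‖ := by
  change ‖(_ : ℂ) * _‖ = _
  rw [norm_mul, Circle.norm_coe, mul_one, Complex.norm_real, norm_norm]

theorem norm_withAngles_one (z : S3) (x : Torus) : ‖(withAngles z x).1 1‖ = ‖z.1 1‖ := by
  change ‖(_ : ℂ) * _‖ = _
  rw [norm_mul, Circle.norm_coe, mul_one, Complex.norm_real, norm_norm]

theorem continuous_withAngles : Continuous fun w : S3 × Torus => withAngles w.1 w.2 := by
  refine Continuous.subtype_mk ((PiLp.continuous_toLp 2 _).comp (continuous_pi fun i => ?_)) _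
  have h : Continuous fun y : UnitAddCircle => (AddCircle.toCircle y : ℂ) :=
    continuous_subtype_val.comp AddCircle.continuous_toCircle
  fin_cases i
  · exact Continuous.mul (by fun_prop) (h.comp (by fun_prop))
  · exact Continuous.mul (by fun_prop) (h.comp (by fun_prop))

theorem withAngles_angles (z : S3) : withAngles z (angles z) = z := by
  ext i
  fin_cases i
  · exact norm_mul_toCircle_polarAngle _
  · exact norm_mul_toCircle_polarAngle _

theorem withAngles_withAngles (z : S3) (x y : Torus) :
    withAngles (withAngles z x) y = withAngles z y := by
  ext i
  fin_cases i
  · change (‖(withAngles z x).1 0‖ : ℂ) * _ = _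
    rw [norm_withAngles_zero]; rfl
  · change (‖(withAngles z x).1 1‖ : ℂ) * _ = _
    rw [norm_withAngles_one]; rfl

theorem angles_withAngles {z : S3} (h₀ : z.1 0 ≠ 0) (h₁ : z.1 1 ≠ 0) (x : Torus) :
    angles (withAngles z x) = x :=
  Prod.ext (polarAngle_mul_toCircle (norm_pos_iff.2 h₀) _)
    (polarAngle_mul_toCircle (norm_pos_iff.2 h₁) _)

/-- A cutoff function on the 3-sphere: it is `1` on the standard torus and `0` near the two core
circles. -/
noncomputable def cutoff (z : S3) : I :=
  ⟨max 0 (1 - 2 * |‖z.1 0‖ ^ 2 - ‖z.1 1‖ ^ 2|), le_max_left _ _,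
    max_le zero_le_one (by linarith [abs_nonneg (‖z.1 0‖ ^ 2 - ‖z.1 1‖ ^ 2)])⟩

theorem continuous_cutoff : Continuous cutoff := by
  refine Continuous.subtype_mk ?_ _
  fun_prop

theorem cutoff_withAngles (z : S3) (x : Torus) : cutoff (withAngles z x) = cutoff z := by
  simp only [cutoff, norm_withAngles_zero, norm_withAngles_one]

theorem eventually_cutoff_eq_zero {z : S3} (h : z.1 0 = 0 ∨ z.1 1 = 0) :
    ∀ᶠ w in 𝓝 z, cutoff w = 0 := by
  have hz : 1 / 2 < |‖z.1 0‖ ^ 2 - ‖z.1 1‖ ^ 2| := by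
    have := sq_add_sq_eq_one z
    rcases h with h | h
    · rw [h, norm_zero] at this ⊢
      rw [abs_of_nonpos] <;> nlinarith
    · rw [h, norm_zero] at this ⊢
      rw [abs_of_nonneg] <;> nlinarith
  have hc : Continuous fun w : S3 => |‖w.1 0‖ ^ 2 - ‖w.1 1‖ ^ 2| := by fun_prop
  filter_upwards [hc.continuousAt.eventually (lt_mem_nhds hz)] with w hw
  exact Subtype.ext (max_eq_left (by linarith))

/-- The extension to the 3-sphere of the homeomorphism `G 1` of the torus, where `G` is an isotopy:
absolute values of the coordinates are kept, and the angles of `z` are moved by `G (cutoff z)`.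
On a core circle one of the two angles is a junk value, but the cutoff vanishes there. -/
noncomputable def extendMap (G : I → (Torus ≃ₜ Torus)) (z : S3) : S3 :=
  withAngles z (G (cutoff z) (angles z))

theorem extendMap_of_cutoff_eq_zero {G : I → (Torus ≃ₜ Torus)} (hG : G 0 = Homeomorph.refl _)
    {z : S3} (hz : cutoff z = 0) : extendMap G z = z := by
  rw [extendMap, hz, hG]
  exact withAngles_angles z

theorem extendMap_symm_extendMap {G H : I → (Torus ≃ₜ Torus)} (hG : G 0 = Homeomorph.refl _)
    (hH : H 0 = Homeomorph.refl _) (hGH : ∀ s x, H s (G s x) = x) (z : S3) :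
    extendMap H (extendMap G z) = z := by
  by_cases h : z.1 0 = 0 ∨ z.1 1 = 0
  · have hz := (eventually_cutoff_eq_zero h).self_of_nhds
    rw [extendMap_of_cutoff_eq_zero hG hz, extendMap_of_cutoff_eq_zero hH hz]
  · rw [not_or] at h
    rw [extendMap, extendMap, withAngles_withAngles, cutoff_withAngles,
      angles_withAngles h.1 h.2, hGH, withAngles_angles]

theorem continuous_extendMap {F : I → (Torus ≃ₜ Torus)}
    (hF : Continuous fun z : I × Torus => F z.1 z.2) (hF0 : F 0 = Homeomorph.refl _) :
    Continuous fun z : I × S3 => extendMap (fun t => F (z.1 * t)) z.2 := by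
  rw [continuous_iff_continuousAt]
  rintro ⟨s, z⟩
  by_cases h : z.1 0 = 0 ∨ z.1 1 = 0
  · refine continuousAt_snd.congr ?_
    have hev : ∀ᶠ w : I × S3 in 𝓝 (s, z), cutoff w.2 = 0 :=
      continuousAt_snd.eventually (eventually_cutoff_eq_zero h)
    filter_upwards [hev] with w hw
    exact (extendMap_of_cutoff_eq_zero (by simpa using hF0) hw).symm
  · rw [not_or] at h
    have ha : ContinuousAt (fun w : I × S3 => angles w.2) (s, z) := by
      refine ContinuousAt.prodMk ?_ ?_
      · exact ContinuousAt.comp (f := fun w : I × S3 => w.2.1 0) (continuousAt_polarAngle h.1)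
          (by fun_prop)
      · exact ContinuousAt.comp (f := fun w : I × S3 => w.2.1 1) (continuousAt_polarAngle h.2)
          (by fun_prop)
    have ht : ContinuousAt (fun w : I × S3 => w.1 * cutoff w.2) (s, z) :=
      (continuous_fst.mul (continuous_cutoff.comp continuous_snd)).continuousAt
    have hx : ContinuousAt (fun w : I × S3 => F (w.1 * cutoff w.2) (angles w.2)) (s, z) :=
      ContinuousAt.comp (f := fun w : I × S3 => (w.1 * cutoff w.2, angles w.2))
        (g := fun w : I × Torus => F w.1 w.2) hF.continuousAt (ht.prodMk ha)
    exact ContinuousAt.comp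
      (f := fun w : I × S3 => (w.2, F (w.1 * cutoff w.2) (angles w.2)))
      (g := fun w : S3 × Torus => withAngles w.1 w.2) continuous_withAngles.continuousAt
      (continuousAt_snd.prodMk hx)

theorem extendMap_clifford (G : I → (Torus ≃ₜ Torus)) (x : Torus) :
    extendMap G (clifford x) = clifford (G 1 x) := by
  have h2 : (0 : ℝ) < (√2)⁻¹ := by positivity
  have h0 : (clifford x).1 0 = ((√2)⁻¹ : ℝ) * (AddCircle.toCircle x.1 : ℂ) := by
    simp [clifford, div_eq_inv_mul]
  have h1 : (clifford x).1 1 = ((√2)⁻¹ : ℝ) * (AddCircle.toCircle x.2 : ℂ) := by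
    simp [clifford, div_eq_inv_mul]
  have n0 : ‖(clifford x).1 0‖ = (√2)⁻¹ := by
    rw [h0, norm_mul, Circle.norm_coe, mul_one, Complex.norm_of_nonneg h2.le]
  have n1 : ‖(clifford x).1 1‖ = (√2)⁻¹ := by
    rw [h1, norm_mul, Circle.norm_coe, mul_one, Complex.norm_of_nonneg h2.le]
  have ha : angles (clifford x) = x := by
    rw [angles, h0, h1, polarAngle_mul_toCircle h2, polarAngle_mul_toCircle h2]
  have hc : cutoff (clifford x) = 1 := by
    refine Subtype.ext ?_
    simp [cutoff, n0, n1]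
  rw [extendMap, ha, hc]
  ext i
  fin_cases i
  · change (‖(clifford x).1 0‖ : ℂ) * _ = _ / _
    rw [n0]; simp [div_eq_inv_mul]
  · change (‖(clifford x).1 1‖ : ℂ) * _ = _ / _
    rw [n1]; simp [div_eq_inv_mul]

/-- An isotopy of the standard torus extends to the 3-sphere. -/
theorem AmbientIsotopic.clifford_image {A B : Set Torus} (h : AmbientIsotopic A B) :
    AmbientIsotopic (clifford '' A) (clifford '' B) := by
  obtain ⟨φ, ⟨F, hF, hF0, rfl⟩, rfl⟩ := h
  have hF' := continuous_symm_of_isotopy hF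
  have hF0' : (F 0).symm = Homeomorph.refl _ := by rw [hF0]; rfl
  have hc := continuous_extendMap hF hF0
  have hc' := continuous_extendMap (F := fun s => (F s).symm) hF' hF0'
  let Φ : I → (S3 ≃ₜ S3) := fun s =>
    { toFun := extendMap fun t => F (s * t)
      invFun := extendMap fun t => (F (s * t)).symm
      left_inv := extendMap_symm_extendMap (by simpa using hF0) (by simpa using hF0') (by simp)
      right_inv := extendMap_symm_extendMap (by simpa using hF0') (by simpa using hF0) (by simp)
      continuous_toFun := hc.comp (continuous_const.prodMk continuous_id)
      continuous_invFun := hc'.comp (continuous_const.prodMk continuous_id) }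
  refine ⟨Φ 1, ⟨Φ, hc, ?_, rfl⟩, ?_⟩
  · ext1 z
    change withAngles z (F (0 * _) _) = z
    rw [zero_mul, hF0]
    exact withAngles_angles z
  · rw [image_image, image_image]
    refine image_congr fun x _ => ?_
    change extendMap (fun t => F (1 * t)) (clifford x) = _
    rw [extendMap_clifford, one_mul]

end TorusKnot

theorem corollary3p4 (n : ℕ) (hn : 2 ≤ n) :
    (∃ C : Fin 5 → Set TorusKnot.Torus,
        C 0 = TorusKnot.J n ∧ TorusKnot.IsPinchSequence C) ∧
      ∀ C : Fin 5 → Set TorusKnot.Torus,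
        C 0 = TorusKnot.J n → TorusKnot.IsPinchSequence C →
          TorusKnot.AmbientIsotopic (TorusKnot.clifford '' C 4)
            (TorusKnot.clifford '' TorusKnot.K (n - 2)) := by
  open TorusKnot in
  obtain ⟨m, rfl⟩ := Nat.exists_eq_add_of_le' hn
  -- `P` stands for the first parameter of the last knot; `J` and `K` are both of the form
  -- `T(p, k p + 1)` with `k = n - 1`.
  have hk : 1 ≤ m + 1 := by lia
  let P := 4 * m
  have hJ : J (m + 2) = T (P + 6 + 2) ((m + 1) * (P + 6 + 2) + 1) := by
    have h1 : 4 * (m + 2) = P + 6 + 2 := by lia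
    have h2 : (2 * (m + 2) - 1) ^ 2 = (m + 1) * (P + 6 + 2) + 1 := by
      rw [show 2 * (m + 2) - 1 = 2 * m + 3 by lia]
      simp only [P]
      ring
    rw [J, h1, h2]
  have hK : K (m + 2 - 2) = T P ((m + 1) * P + 1) := by
    have h2 : (2 * m + 1) ^ 2 = (m + 1) * P + 1 := by
      simp only [P]
      ring
    rw [Nat.add_sub_cancel, K, h2]
  rw [hJ, hK]
  constructor
  · have i₀ := AmbientIsotopic.refl (T (P + 6 + 2) ((m + 1) * (P + 6 + 2) + 1))
    obtain ⟨C₁, h₁⟩ := exists_isPinchMove hk i₀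
    have i₁ := h₁.ambientIsotopic_T hk i₀
    obtain ⟨C₂, h₂⟩ := exists_isPinchMove (p := P + 4) hk i₁
    have i₂ := h₂.ambientIsotopic_T (p := P + 4) hk i₁
    obtain ⟨C₃, h₃⟩ := exists_isPinchMove (p := P + 2) hk i₂
    have i₃ := h₃.ambientIsotopic_T (p := P + 2) hk i₂
    obtain ⟨C₄, h₄⟩ := exists_isPinchMove (p := P) hk i₃
    refine ⟨![_, C₁, C₂, C₃, C₄], rfl, fun i => ?_⟩
    fin_cases i
    exacts [h₁, h₂, h₃, h₄]
  · intro C h0 hC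
    have i₀ := AmbientIsotopic.refl (C 0)
    nth_rewrite 1 [h0] at i₀
    have i₁ := (hC 0).ambientIsotopic_T hk i₀
    have i₂ := (hC 1).ambientIsotopic_T (p := P + 4) hk i₁
    have i₃ := (hC 2).ambientIsotopic_T (p := P + 2) hk i₂
    have i₄ := (hC 3).ambientIsotopic_T (p := P) hk i₃
    exact i₄.symm.clifford_image
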